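/- A commutative ring $R$ is (von Neumann) regular if for every $x\in R$ there is $y\in R$ with $x^2y=x$ and $y^2x=y$; such a $y$ is unique and is written $x^*$. Let $\mathcal C$ be the category of finitely presented regular rings, i.e. of regular rings presented by finitely many generators and finitely many equations in the language of commutative rings with the additional unary operation $x\mapsto x^*$, regarded as a full subcategory of the category of commutative rings. Let $J$ be the smallest Grothendieck topology on $\mathcal C^{\mathrm{op}}$ for which the zero ring is covered by the empty cosieve and, for every object $R$ of $\mathcal C$ and every $a\in R$, $R$ is covered by the cosieve generated by the two quotient maps $R\to R/(a)$ and $R\to R/(aa^*-1)$. Proposition 1.4. The topos $\mathrm{Sh}(\mathcal C^{\mathrm{op}},J)$ does not satisfy De Morgan's law; that is, it is not the case that $\neg(A\wedge B)=\neg A\vee\neg B$ for all objects $X$ and all subobjects $A,B$ of $X$, where $\neg$, $\wedge$, $\vee$ are taken in the lattice of subobjects of $X$. -/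

import Mathlib

open CategoryTheory CategoryTheory.Limits

universe u v w

/-! ### Von Neumann regular rings -/

/-- A commutative ring is (von Neumann) regular if every `x` has a `y` with
`x ^ 2 * y = x` and `y ^ 2 * x = y`. -/
def IsVonNeumannRegular (R : Type u) [CommRing R] : Prop :=
  ∀ x : R, ∃ y : R, x ^ 2 * y = x ∧ y ^ 2 * x = y

/-- The element `y` with `x ^ 2 * y = x` and `y ^ 2 * x = y` is unique if it exists. -/
theorem weakInverse_unique {R : Type u} [CommRing R] {x y z : R}
    (hy : x ^ 2 * y = x ∧ y ^ 2 * x = y) (hz : x ^ 2 * z = x ∧ z ^ 2 * x = z) : y = z := by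
  obtain ⟨h1, h2⟩ := hy
  obtain ⟨h3, h4⟩ := hz
  have e : x * y = x * z := by
    calc x * y = (x ^ 2 * z) * y := by rw [h3]
      _ = (x ^ 2 * y) * z := by ring
      _ = x * z := by rw [h1]
  calc y = y * (x * y) := by linear_combination -h2
    _ = z * (x * z) := by linear_combination (y + z) * e
    _ = z := by linear_combination h4

open Classical in
/-- The unary operation `x ↦ x*` of a regular ring: `x*` is the unique `y` with
`x ^ 2 * y = x` and `y ^ 2 * x = y` (and `0` if there is none, which does not
happen in a regular ring). -/
noncomputable def weakInverse {R : Type u} [CommRing R] (x : R) : R :=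
  if h : ∃ y : R, x ^ 2 * y = x ∧ y ^ 2 * x = y then h.choose else 0

/-- Terms in `n` variables in the language of commutative rings with the additional
unary operation `x ↦ x*`. -/
inductive RegTerm (n : ℕ) : Type
  | var : Fin n → RegTerm n
  | zero : RegTerm n
  | one : RegTerm n
  | add : RegTerm n → RegTerm n → RegTerm n
  | mul : RegTerm n → RegTerm n → RegTerm n
  | neg : RegTerm n → RegTerm n
  | star : RegTerm n → RegTerm n

/-- The value of a term at a tuple of ring elements. -/
noncomputable def RegTerm.eval {R : Type u} [CommRing R] {n : ℕ} (x : Fin n → R) :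
    RegTerm n → R
  | .var i => x i
  | .zero => 0
  | .one => 1
  | .add s t => s.eval x + t.eval x
  | .mul s t => s.eval x * t.eval x
  | .neg s => -s.eval x
  | .star s => weakInverse (s.eval x)

/-- The tuple `x` satisfies all the equations `s = t` for `(s, t)` in the list `rel`. -/
def SatisfiesRel {R : Type u} [CommRing R] {n : ℕ} (rel : List (RegTerm n × RegTerm n))
    (x : Fin n → R) : Prop :=
  ∀ r ∈ rel, r.1.eval x = r.2.eval x

/-- A regular ring is finitely presented (as a regular ring) if it is the regular ring
generated by finitely many elements `x i` subject to finitely many equations between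
terms in these elements, in the language with `x ↦ x*`. Ring homomorphisms between
regular rings preserve `x ↦ x*`, so they are the homomorphisms of such structures. -/
def IsFPRegularRing (R : Type u) [CommRing R] : Prop :=
  IsVonNeumannRegular R ∧
    ∃ (n : ℕ) (rel : List (RegTerm n × RegTerm n)) (x : Fin n → R), SatisfiesRel rel x ∧
      ∀ (S : Type u) [CommRing S], IsVonNeumannRegular S →
        ∀ y : Fin n → S, SatisfiesRel rel y → ∃! f : R →+* S, ∀ i, f (x i) = y i

/-- The category of finitely presented regular rings, as a full subcategory of the
category of commutative rings. -/
abbrev FPRegRing : Type (u + 1) :=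
  ObjectProperty.FullSubcategory (fun R : CommRingCat.{u} => IsFPRegularRing R)

/-! ### The coverage for fields -/

/-- The ring homomorphism `R → S` underlying an arrow `op S ⟶ op R` of the opposite of the
category of finitely presented regular rings. -/
def FPRegRing.ringHom {X Y : FPRegRing.{u}ᵒᵖ} (f : Y ⟶ X) : X.unop.obj →+* Y.unop.obj :=
  f.unop.hom.hom

/-- The two quotient maps `R → R / (a)` and `R → R / (a a* - 1)`, up to isomorphism of the
codomain: the surjective homomorphisms out of `R` whose kernel is one of the two ideals. -/
def fieldPresieve (X : FPRegRing.{u}ᵒᵖ) (a : X.unop.obj) : Presieve X := fun _ f =>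
  Function.Surjective (FPRegRing.ringHom f) ∧
    (RingHom.ker (FPRegRing.ringHom f) = Ideal.span {a} ∨
      RingHom.ker (FPRegRing.ringHom f) = Ideal.span {a * weakInverse a - 1})

/-- The smallest Grothendieck topology on the opposite of the category of finitely presented
regular rings for which the zero ring is covered by the empty sieve and each `R` is covered,
for each `a ∈ R`, by the (co)sieve generated by `R → R / (a)` and `R → R / (a a* - 1)`. -/
noncomputable def fieldTopology : GrothendieckTopology FPRegRing.{u}ᵒᵖ :=
  sInf {J | (∀ X : FPRegRing.{u}ᵒᵖ, Subsingleton X.unop.obj → (⊥ : Sieve X) ∈ J X) ∧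
    ∀ (X : FPRegRing.{u}ᵒᵖ) (a : X.unop.obj), Sieve.generate (fieldPresieve X a) ∈ J X}

/-! ### De Morgan's law -/

/-- `b` is the negation (pseudocomplement) of `a`: the largest element disjoint from `a`.
It is unique when it exists; in the lattice of subobjects of an object of a topos it
always exists. -/
def IsNegation {α : Type w} [SemilatticeInf α] (a b : α) : Prop :=
  IsGreatest {x : α | IsBot (a ⊓ x)} b

/-- De Morgan's law in a topos: `¬(A ∧ B) = ¬A ∨ ¬B` for all subobjects `A`, `B` of every
object. The negations of `A`, `B` and `A ∧ B` are the elements `A'`, `B'`, `N`, and the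
join is expressed as a least upper bound. -/
def SatisfiesDeMorgan (E : Type v) [Category.{w} E] [HasPullbacks E] : Prop :=
  ∀ (X : E) (A B A' B' N : Subobject X),
    IsNegation A A' → IsNegation B B' → IsNegation (A ⊓ B) N → IsLUB {A', B'} N

/-! ### Regular rings and terms -/

/-! The counterexample lives among subobjects of the terminal sheaf, which are the classes of rings
stable under homomorphisms and local for the covers. A homomorphism-stable property that holds for
the zero ring and is stable under binary products defines such a class
(`IsLocalRingProperty.isClosedClass`), since R is the product of R/(a) and R/(aa* - 1).

Let S and T be the primes congruent to 1 and to 3 modulo 4, let A say that some product of primes in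
S is zero, and let B say the same for T. By Bézout A ∧ B forces 1 = 0, so ¬(A ∧ B) is everything. On
the other hand ¬A says that all primes in S are invertible (`isNegation_hasTorsionIn`), and likewise
for ¬B. Both lie below the subobject U of rings with an idempotent separating S from T, so De
Morgan's law would put such an idempotent e in the initial regular ring.

There e is a closed term, so for some fixed a/N its value in 𝔽_p is a/N for all p not dividing N
(`RegTerm.exists_mul_eval_eq_intCast`). Separation makes this value 1 at the primes of S and 0 at
those of T; both sets being infinite, a = N and a = 0, a contradiction. Geometrically, the spectrum
is the one-point compactification of the set of primes: the generic point is a limit of both S and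
T, so no clopen set separates them. -/

theorem weakInverse_eq {R : Type u} [CommRing R] {x y : R}
    (h : x ^ 2 * y = x ∧ y ^ 2 * x = y) : weakInverse x = y := by
  have hx : ∃ y : R, x ^ 2 * y = x ∧ y ^ 2 * x = y := ⟨y, h⟩
  rw [weakInverse, dif_pos hx]
  exact weakInverse_unique hx.choose_spec h

namespace IsVonNeumannRegular

theorem weakInverse_spec {R : Type u} [CommRing R] (hR : IsVonNeumannRegular R) (x : R) :
    x ^ 2 * weakInverse x = x ∧ weakInverse x ^ 2 * x = weakInverse x := by
  obtain ⟨y, hy⟩ := hR x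
  rwa [weakInverse_eq hy]

/-- The equations defining x* are preserved by any ring homomorphism and determine x*, so the target
need not be regular. -/
theorem map_weakInverse {R : Type u} {S : Type v} [CommRing R] [CommRing S]
    (hR : IsVonNeumannRegular R) (f : R →+* S) (x : R) :
    f (weakInverse x) = weakInverse (f x) := by
  obtain ⟨h1, h2⟩ := hR.weakInverse_spec x
  refine (weakInverse_eq ⟨?_, ?_⟩).symm
  · rw [← map_pow, ← map_mul, h1]
  · rw [← map_pow, ← map_mul, h2]

theorem map_eval {R : Type u} {S : Type v} [CommRing R] [CommRing S]
    (hR : IsVonNeumannRegular R) (f : R →+* S) {n : ℕ} (x : Fin n → R) (t : RegTerm n) :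
    f (t.eval x) = t.eval (fun i => f (x i)) := by
  induction t with
  | var i => rfl
  | zero => exact map_zero f
  | one => exact map_one f
  | add s t hs ht => simp only [RegTerm.eval, map_add, hs, ht]
  | mul s t hs ht => simp only [RegTerm.eval, map_mul, hs, ht]
  | neg s hs => simp only [RegTerm.eval, map_neg, hs]
  | star s hs => simp only [RegTerm.eval, hR.map_weakInverse, hs]

theorem of_surjective {R : Type u} {S : Type v} [CommRing R] [CommRing S]
    (hR : IsVonNeumannRegular R) (f : R →+* S) (hf : Function.Surjective f) :
    IsVonNeumannRegular S := by
  intro s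
  obtain ⟨x, rfl⟩ := hf s
  obtain ⟨y, h1, h2⟩ := hR x
  exact ⟨f y, by rw [← map_pow, ← map_mul, h1], by rw [← map_pow, ← map_mul, h2]⟩

theorem of_field (F : Type u) [Field F] : IsVonNeumannRegular F := by
  intro x
  by_cases hx : x = 0
  · exact ⟨0, by simp [hx]⟩
  · exact ⟨x⁻¹, by field_simp, by field_simp⟩

end IsVonNeumannRegular

/-- The subring of the values of terms at a tuple in a ring. -/
noncomputable def termSubring {R : Type u} [CommRing R] {n : ℕ} (x : Fin n → R) : Subring R where
  carrier := Set.range fun t : RegTerm n => t.eval x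
  mul_mem' := by rintro _ _ ⟨s, rfl⟩ ⟨t, rfl⟩; exact ⟨s.mul t, rfl⟩
  one_mem' := ⟨.one, rfl⟩
  add_mem' := by rintro _ _ ⟨s, rfl⟩ ⟨t, rfl⟩; exact ⟨s.add t, rfl⟩
  zero_mem' := ⟨.zero, rfl⟩
  neg_mem' := by rintro _ ⟨s, rfl⟩; exact ⟨s.neg, rfl⟩

theorem termSubring_isVonNeumannRegular {R : Type u} [CommRing R] (hR : IsVonNeumannRegular R)
    {n : ℕ} (x : Fin n → R) : IsVonNeumannRegular (termSubring x) := by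
  rintro ⟨_, t, rfl⟩
  obtain ⟨h1, h2⟩ := hR.weakInverse_spec (t.eval x)
  exact ⟨⟨weakInverse (t.eval x), t.star, rfl⟩, Subtype.ext h1, Subtype.ext h2⟩

/-- The universal property of a presentation forces the given tuple to generate. -/
theorem exists_eval_eq_of_presentation {R : Type u} [CommRing R] (hR : IsVonNeumannRegular R)
    {n : ℕ} {rel : List (RegTerm n × RegTerm n)} {x : Fin n → R} (hx : SatisfiesRel rel x)
    (huniv : ∀ (S : Type u) [CommRing S], IsVonNeumannRegular S →
      ∀ y : Fin n → S, SatisfiesRel rel y → ∃! f : R →+* S, ∀ i, f (x i) = y i) (b : R) :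
    ∃ t : RegTerm n, t.eval x = b := by
  have hT := termSubring_isVonNeumannRegular hR x
  let y : Fin n → termSubring x := fun i => ⟨x i, .var i, rfl⟩
  have hy : SatisfiesRel rel y := fun r hr => Subtype.ext (by
    have h := hx r hr
    have e (t : RegTerm n) : ((t.eval y : termSubring x) : R) = t.eval x :=
      hT.map_eval (termSubring x).subtype y t
    rw [e, e, h])
  obtain ⟨f, hf, -⟩ := huniv _ hT y hy
  -- An endomorphism of R fixing the generators is the identity; this one factors through the
  -- subring of term values.
  have hid : (termSubring x).subtype.comp f = RingHom.id R :=
    (huniv R hR x hx).unique (fun i => by simp [hf i, y]) (fun i => rfl)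
  have hb : ((f b : termSubring x) : R) = b := DFunLike.congr_fun hid b
  exact hb ▸ (f b).2

/-- Since b is the value of a term t, adding the equation t = 0 to a presentation of R presents the
quotient. -/
theorem IsFPRegularRing.quotient_span {R : Type u} [CommRing R] (hR : IsFPRegularRing R) (b : R) :
    IsFPRegularRing (R ⧸ Ideal.span {b}) := by
  obtain ⟨hreg, n, rel, x, hx, huniv⟩ := hR
  obtain ⟨t, rfl⟩ := exists_eval_eq_of_presentation hreg hx huniv b
  set I : Ideal R := Ideal.span {t.eval x}
  have hmk : Function.Surjective (Ideal.Quotient.mk I) := Ideal.Quotient.mk_surjective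
  refine ⟨hreg.of_surjective _ hmk, n, (t, .zero) :: rel, fun i => Ideal.Quotient.mk I (x i),
    ?_, ?_⟩
  · intro r hr
    rw [← hreg.map_eval, ← hreg.map_eval]
    rcases List.mem_cons.1 hr with rfl | hr
    · simp only [RegTerm.eval, map_zero]
      exact Ideal.Quotient.eq_zero_iff_mem.2 (Ideal.mem_span_singleton_self _)
    · rw [hx r hr]
  · intro S _ hS y hy
    obtain ⟨f, hf, hfu⟩ := huniv S hS y fun r hr => hy r (List.mem_cons_of_mem _ hr)
    have hfI : ∀ a ∈ I, f a = 0 := by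
      intro a ha
      obtain ⟨c, rfl⟩ := Ideal.mem_span_singleton.1 ha
      have h0 : t.eval y = 0 := hy _ List.mem_cons_self
      rw [map_mul, hreg.map_eval, funext hf, h0, zero_mul]
    refine ⟨Ideal.Quotient.lift I f hfI, fun i => by simp [hf], fun g hg => ?_⟩
    refine Ideal.Quotient.ringHom_ext ?_
    rw [hfu (g.comp (Ideal.Quotient.mk I)) hg]
    ext a
    simp

/-! ### The initial regular ring -/

/-- Closed terms are identified when they agree in all regular rings. -/
def closedTermSetoid : Setoid (RegTerm 0) where
  r s t := ∀ (S : Type u) [CommRing S], IsVonNeumannRegular S →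
    s.eval (Fin.elim0 : Fin 0 → S) = t.eval Fin.elim0
  iseqv := ⟨fun _ _ _ _ => rfl, fun h S _ hS => (h S hS).symm,
    fun h h' S _ hS => (h S hS).trans (h' S hS)⟩

/-- The ring of closed terms modulo equality in all regular rings. -/
def ClosedTermRing : Type := Quotient closedTermSetoid.{u}

namespace ClosedTermRing

/-- The class of a closed term. -/
def mk (t : RegTerm 0) : ClosedTermRing.{u} := Quotient.mk _ t

theorem mk_surjective : Function.Surjective mk.{u} := Quotient.mk_surjective

theorem mk_eq {s t : RegTerm 0} (h : ∀ (S : Type u) [CommRing S], IsVonNeumannRegular S →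
    s.eval (Fin.elim0 : Fin 0 → S) = t.eval Fin.elim0) : mk.{u} s = mk t :=
  Quotient.sound h

instance : Zero ClosedTermRing.{u} := ⟨mk .zero⟩
instance : One ClosedTermRing.{u} := ⟨mk .one⟩
instance : Neg ClosedTermRing.{u} :=
  ⟨Quotient.map .neg fun _ _ h S _ hS => congrArg Neg.neg (h S hS)⟩
instance : Add ClosedTermRing.{u} :=
  ⟨Quotient.map₂ .add fun _ _ h _ _ h' S _ hS => congrArg₂ (· + ·) (h S hS) (h' S hS)⟩
instance : Mul ClosedTermRing.{u} :=
  ⟨Quotient.map₂ .mul fun _ _ h _ _ h' S _ hS => congrArg₂ (· * ·) (h S hS) (h' S hS)⟩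

theorem mk_neg (s : RegTerm 0) : mk.{u} s.neg = -mk s := rfl
theorem mk_add (s t : RegTerm 0) : mk.{u} (s.add t) = mk s + mk t := rfl
theorem mk_mul (s t : RegTerm 0) : mk.{u} (s.mul t) = mk s * mk t := rfl

instance : CommRing ClosedTermRing.{u} where
  add_assoc := mk_surjective.forall₃.2 fun a b c => mk_eq fun S _ _ => add_assoc _ _ _
  zero_add := mk_surjective.forall.2 fun a => mk_eq fun S _ _ => zero_add _
  add_zero := mk_surjective.forall.2 fun a => mk_eq fun S _ _ => add_zero _
  add_comm := mk_surjective.forall₂.2 fun a b => mk_eq fun S _ _ => add_comm _ _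
  left_distrib := mk_surjective.forall₃.2 fun a b c => mk_eq fun S _ _ => mul_add _ _ _
  right_distrib := mk_surjective.forall₃.2 fun a b c => mk_eq fun S _ _ => add_mul _ _ _
  zero_mul := mk_surjective.forall.2 fun a => mk_eq fun S _ _ => zero_mul _
  mul_zero := mk_surjective.forall.2 fun a => mk_eq fun S _ _ => mul_zero _
  mul_assoc := mk_surjective.forall₃.2 fun a b c => mk_eq fun S _ _ => mul_assoc _ _ _
  one_mul := mk_surjective.forall.2 fun a => mk_eq fun S _ _ => one_mul _
  mul_one := mk_surjective.forall.2 fun a => mk_eq fun S _ _ => mul_one _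
  mul_comm := mk_surjective.forall₂.2 fun a b => mk_eq fun S _ _ => mul_comm _ _
  neg_add_cancel := mk_surjective.forall.2 fun a => mk_eq fun S _ _ => neg_add_cancel _
  nsmul := nsmulRec
  zsmul := zsmulRec

theorem isVonNeumannRegular : IsVonNeumannRegular ClosedTermRing.{u} := by
  intro x
  obtain ⟨t, rfl⟩ := mk_surjective x
  refine ⟨mk t.star, ?_, ?_⟩
  · rw [pow_two]
    exact mk_eq fun S _ hS => (congrArg (· * _) (pow_two _)).symm.trans (hS.weakInverse_spec _).1
  · rw [pow_two]
    exact mk_eq fun S _ hS => (congrArg (· * _) (pow_two _)).symm.trans (hS.weakInverse_spec _).2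

theorem eval_eq_mk (t : RegTerm 0) : t.eval (Fin.elim0 : Fin 0 → ClosedTermRing.{u}) = mk t := by
  induction t with
  | var i => exact i.elim0
  | zero => rfl
  | one => rfl
  | add s t hs ht => simp only [RegTerm.eval, hs, ht, mk_add]
  | mul s t hs ht => simp only [RegTerm.eval, hs, ht, mk_mul]
  | neg s hs => simp only [RegTerm.eval, hs, mk_neg]
  | star s hs =>
    simp only [RegTerm.eval, hs]
    refine weakInverse_eq ⟨?_, ?_⟩ <;> rw [pow_two] <;> refine mk_eq fun S _ hS => ?_
    · exact (congrArg (· * _) (pow_two _)).symm.trans (hS.weakInverse_spec _).1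
    · exact (congrArg (· * _) (pow_two _)).symm.trans (hS.weakInverse_spec _).2

/-- Evaluation of closed terms in a regular ring. -/
noncomputable def lift (S : Type u) [CommRing S] (hS : IsVonNeumannRegular S) :
    ClosedTermRing.{u} →+* S where
  toFun := Quotient.lift (fun t => t.eval Fin.elim0) fun _ _ h => h S hS
  map_one' := rfl
  map_zero' := rfl
  map_mul' := mk_surjective.forall₂.2 fun _ _ => rfl
  map_add' := mk_surjective.forall₂.2 fun _ _ => rfl

/-- Each class is the value of its own representative, and homomorphisms preserve values; hence
there is at most one homomorphism to each ring. -/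
theorem map_mk {S : Type v} [CommRing S] (f : ClosedTermRing.{u} →+* S) (t : RegTerm 0) :
    f (mk t) = t.eval Fin.elim0 := by
  rw [← eval_eq_mk, isVonNeumannRegular.map_eval]
  congr 1
  exact Subsingleton.elim _ _

theorem isFPRegularRing : IsFPRegularRing (ULift.{u} ClosedTermRing.{u}) := by
  refine ⟨isVonNeumannRegular.of_surjective
    (ULift.ringEquiv.symm : ClosedTermRing.{u} ≃+* ULift.{u} _).toRingHom
    ULift.ringEquiv.symm.surjective, 0, [], Fin.elim0, by simp [SatisfiesRel], ?_⟩
  intro S _ hS y _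
  refine ⟨(lift S hS).comp ULift.ringEquiv.toRingHom, fun i => i.elim0, fun g _ => ?_⟩
  ext ⟨x⟩
  obtain ⟨t, rfl⟩ := mk_surjective x
  have h := map_mk (g.comp ULift.ringEquiv.symm.toRingHom) t
  exact h

end ClosedTermRing

/-- A closed term takes the value `a / N` in all fields in which `N` is invertible, for some
integers `a` and `N ≠ 0`. -/
theorem RegTerm.exists_mul_eval_eq_intCast (t : RegTerm 0) :
    ∃ N a : ℤ, N ≠ 0 ∧ ∀ (F : Type u) [Field F], (N : F) ≠ 0 →
      (N : F) * t.eval Fin.elim0 = a := by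
  induction t with
  | var i => exact i.elim0
  | zero => exact ⟨1, 0, one_ne_zero, fun F _ _ => by simp [RegTerm.eval]⟩
  | one => exact ⟨1, 1, one_ne_zero, fun F _ _ => by simp [RegTerm.eval]⟩
  | add s t hs ht =>
    obtain ⟨N, a, hN, h⟩ := hs
    obtain ⟨M, b, hM, h'⟩ := ht
    refine ⟨N * M, a * M + b * N, mul_ne_zero hN hM, fun F _ hF => ?_⟩
    push_cast at hF ⊢
    have e := h F (left_ne_zero_of_mul hF)
    have e' := h' F (right_ne_zero_of_mul hF)
    simp only [RegTerm.eval]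
    linear_combination (M : F) * e + (N : F) * e'
  | mul s t hs ht =>
    obtain ⟨N, a, hN, h⟩ := hs
    obtain ⟨M, b, hM, h'⟩ := ht
    refine ⟨N * M, a * b, mul_ne_zero hN hM, fun F _ hF => ?_⟩
    push_cast at hF ⊢
    rw [← h F (left_ne_zero_of_mul hF), ← h' F (right_ne_zero_of_mul hF)]
    simp only [RegTerm.eval]
    ring
  | neg s hs =>
    obtain ⟨N, a, hN, h⟩ := hs
    refine ⟨N, -a, hN, fun F _ hF => ?_⟩
    push_cast
    rw [← h F hF]
    simp only [RegTerm.eval]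
    ring
  | star s hs =>
    obtain ⟨N, a, hN, h⟩ := hs
    -- If a = 0 the value is 0 and 0* = 0. Otherwise, once a is also invertible, the value a/N has
    -- inverse N/a, written N²/(Na) so that the new denominator still forces N ≠ 0.
    by_cases ha : a = 0
    · refine ⟨N, 0, hN, fun F _ hF => ?_⟩
      have e := h F hF
      rw [ha, Int.cast_zero, mul_eq_zero, or_iff_right hF] at e
      have e' : weakInverse (0 : F) = 0 := weakInverse_eq (by simp)
      simp [RegTerm.eval, e, e']
    · refine ⟨N * a, N * N, mul_ne_zero hN ha, fun F _ hF => ?_⟩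
      push_cast at hF ⊢
      have e := h F (left_ne_zero_of_mul hF)
      have hs : s.eval (Fin.elim0 : Fin 0 → F) ≠ 0 := fun h0 => by
        rw [h0, mul_zero] at e
        exact right_ne_zero_of_mul hF e.symm
      have e' : weakInverse (s.eval (Fin.elim0 : Fin 0 → F)) = (s.eval Fin.elim0)⁻¹ :=
        weakInverse_eq ⟨by field_simp, by field_simp⟩
      simp only [RegTerm.eval, e', ← e]
      field_simp

/-! ### Subterminal sheaves -/

section Subterminal

variable {C : Type v} [Category.{w} C]

/-- A class of objects is closed for a topology if it is stable under morphisms into its members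
and contains each object that is covered by members. -/
structure IsClosedClass (J : GrothendieckTopology C) (P : C → Prop) : Prop where
  of_hom : ∀ {X Y : C}, (Y ⟶ X) → P X → P Y
  of_cover : ∀ {X : C} (S : Sieve X), S ∈ J X → (∀ ⦃Y : C⦄ (f : Y ⟶ X), S f → P Y) → P X

/-- The presheaf which has exactly one section over the members of a class, and none over the
other objects. -/
def classPresheaf (P : C → Prop) (hP : ∀ {X Y : C}, (Y ⟶ X) → P X → P Y) : Cᵒᵖ ⥤ Type u where
  obj X := ULift (PLift (P X.unop))
  map f := TypeCat.ofHom fun s => ⟨⟨hP f.unop s.down.down⟩⟩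

instance (P : C → Prop) (hP : ∀ {X Y : C}, (Y ⟶ X) → P X → P Y) (X : Cᵒᵖ) :
    Subsingleton ((classPresheaf.{u} P hP).obj X) :=
  inferInstanceAs (Subsingleton (ULift (PLift (P X.unop))))

theorem classPresheaf_isSheafFor {P : C → Prop} {hP : ∀ {X Y : C}, (Y ⟶ X) → P X → P Y}
    {X : C} {S : Presieve X} (h : (∀ ⦃Y : C⦄ (f : Y ⟶ X), S f → P Y) → P X) :
    Presieve.IsSheafFor (classPresheaf.{u} P hP) S := by
  intro x _
  exact ⟨⟨⟨h fun Y f hf => (x f hf).down.down⟩⟩, fun Y f hf => Subsingleton.elim _ _,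
    fun _ _ => Subsingleton.elim _ _⟩

theorem of_classPresheaf_isSheafFor {P : C → Prop} {hP : ∀ {X Y : C}, (Y ⟶ X) → P X → P Y}
    {X : C} {S : Presieve X} (h : Presieve.IsSheafFor (classPresheaf.{u} P hP) S)
    (hS : ∀ ⦃Y : C⦄ (f : Y ⟶ X), S f → P Y) : P X := by
  obtain ⟨t, -, -⟩ := h (fun Y f hf => ⟨⟨hS f hf⟩⟩) fun _ _ _ _ _ _ _ _ _ _ =>
    Subsingleton.elim _ _
  exact t.down.down

variable {J : GrothendieckTopology C}

/-- The subterminal sheaf of a closed class. -/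
def classSheaf {P : C → Prop} (hP : IsClosedClass J P) : Sheaf J (Type u) where
  obj := classPresheaf P hP.of_hom
  property := (isSheaf_iff_isSheaf_of_type _ _).2 fun _ S hS =>
    classPresheaf_isSheafFor (hP.of_cover S hS)

theorem IsClosedClass.true : IsClosedClass J fun _ : C => True := ⟨fun _ _ => ⟨⟩, fun _ _ _ => ⟨⟩⟩

variable (J) in
/-- The terminal sheaf. -/
def trueSheaf : Sheaf J (Type u) := classSheaf IsClosedClass.true

instance (X : Cᵒᵖ) : Subsingleton ((trueSheaf.{u} J).obj.obj X) :=
  inferInstanceAs (Subsingleton (ULift (PLift True)))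

instance (F : Sheaf J (Type u)) : Subsingleton (F ⟶ trueSheaf.{u} J) :=
  ⟨fun f g => Sheaf.hom_ext (NatTrans.ext (funext fun X => by
    ext s
    exact Subsingleton.elim (α := (trueSheaf.{u} J).obj.obj X) _ _))⟩

/-- Morphisms out of any sheaf to a sheaf with at most one section over each object. -/
noncomputable def homOfNonempty (F G : Sheaf J (Type u)) [∀ X, Subsingleton (G.obj.obj X)]
    (h : ∀ X, Nonempty (F.obj.obj X) → Nonempty (G.obj.obj X)) : F ⟶ G :=
  ObjectProperty.homMk
    { app := fun X => TypeCat.ofHom fun s => (h X ⟨s⟩).some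
      naturality := fun X Y f => by
        ext s
        exact Subsingleton.elim (α := G.obj.obj Y) _ _ }

instance {P : C → Prop} (hP : IsClosedClass J P) (X : Cᵒᵖ) :
    Subsingleton ((classSheaf.{u} hP).obj.obj X) :=
  inferInstanceAs (Subsingleton (ULift (PLift _)))

/-- The inclusion of a subterminal sheaf. -/
noncomputable def classSheafι {P : C → Prop} (hP : IsClosedClass J P) :
    classSheaf.{u} hP ⟶ trueSheaf J :=
  homOfNonempty _ _ fun _ _ => ⟨⟨⟨⟨⟩⟩⟩⟩

instance {P : C → Prop} (hP : IsClosedClass J P) : Mono (classSheafι.{u} hP) :=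
  ⟨fun f g _ => Sheaf.hom_ext (NatTrans.ext (funext fun X => by
    ext s
    exact Subsingleton.elim (α := (classSheaf.{u} hP).obj.obj X) _ _))⟩

/-- The subobject of the terminal sheaf given by a closed class. -/
noncomputable def classSubobject {P : C → Prop} (hP : IsClosedClass J P) :
    Subobject (trueSheaf.{u} J) :=
  Subobject.mk (classSheafι hP)

/-- The class of objects over which a subobject of the terminal sheaf has a section. -/
def subobjectSupport (y : Subobject (trueSheaf.{u} J)) (X : C) : Prop :=
  Nonempty ((y : Sheaf J (Type u)).obj.obj (Opposite.op X))

/-- Passing from sheaves to presheaves preserves monomorphisms, so sections of a subobject inject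
into those of the terminal sheaf. -/
instance subsingleton_sections (y : Subobject (trueSheaf.{u} J)) (X : Cᵒᵖ) :
    Subsingleton ((y : Sheaf J (Type u)).obj.obj X) := by
  have h : Mono ((sheafToPresheaf J (Type u)).map y.arrow) := inferInstance
  have h' := (NatTrans.mono_iff_mono_app _).1 h X
  have h'' := (mono_iff_injective _).1 h'
  exact ⟨fun a b => h'' (Subsingleton.elim (α := (trueSheaf.{u} J).obj.obj X) _ _)⟩

theorem subobjectSupport_mono {x y : Subobject (trueSheaf.{u} J)} (h : x ≤ y) {X : C}
    (hX : subobjectSupport x X) : subobjectSupport y X :=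
  hX.map ((Subobject.ofLE x y h).hom.app (Opposite.op X))

theorem le_iff_subobjectSupport {x y : Subobject (trueSheaf.{u} J)} :
    x ≤ y ↔ ∀ X, subobjectSupport x X → subobjectSupport y X :=
  ⟨fun h _ => subobjectSupport_mono h, fun h =>
    Subobject.le_of_comm (homOfNonempty _ _ fun X => h X.unop) (Subsingleton.elim _ _)⟩

theorem subobjectSupport_classSubobject {P : C → Prop} (hP : IsClosedClass J P) (X : C) :
    subobjectSupport (classSubobject.{u} hP) X ↔ P X := by
  refine ⟨fun ⟨s⟩ => ?_, fun h => ?_⟩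
  · exact ((Subobject.underlyingIso (classSheafι.{u} hP)).hom.hom.app (Opposite.op X) s).down.down
  · exact ⟨(Subobject.underlyingIso (classSheafι.{u} hP)).inv.hom.app (Opposite.op X) ⟨⟨h⟩⟩⟩

theorem isClosedClass_subobjectSupport (y : Subobject (trueSheaf.{u} J)) :
    IsClosedClass J (subobjectSupport y) where
  of_hom f := Nonempty.map ((y : Sheaf J (Type u)).obj.map f.op)
  of_cover S hS h := by
    obtain ⟨t, -, -⟩ := (isSheaf_iff_isSheaf_of_type _ _).1 (y : Sheaf J (Type u)).property S hS
      (fun Y f hf => (h f hf).some) fun _ _ _ _ _ _ _ _ _ _ => Subsingleton.elim _ _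
    exact ⟨t⟩

theorem IsClosedClass.and {P Q : C → Prop} (hP : IsClosedClass J P) (hQ : IsClosedClass J Q) :
    IsClosedClass J fun X => P X ∧ Q X where
  of_hom f h := ⟨hP.of_hom f h.1, hQ.of_hom f h.2⟩
  of_cover S hS h := ⟨hP.of_cover S hS fun _ f hf => (h f hf).1,
    hQ.of_cover S hS fun _ f hf => (h f hf).2⟩

variable [HasPullbacks (Sheaf J (Type u))]

theorem subobjectSupport_inf (x y : Subobject (trueSheaf.{u} J)) (X : C) :
    subobjectSupport (x ⊓ y) X ↔ subobjectSupport x X ∧ subobjectSupport y X := by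
  refine ⟨fun h => ⟨subobjectSupport_mono inf_le_left h, subobjectSupport_mono inf_le_right h⟩,
    fun h => ?_⟩
  -- The intersection of the supports is a closed class, and its subobject is a lower bound of x and
  -- y; no pullback has to be computed.
  have hc := (isClosedClass_subobjectSupport x).and (isClosedClass_subobjectSupport y)
  refine subobjectSupport_mono (x := classSubobject hc) (le_inf ?_ ?_)
    ((subobjectSupport_classSubobject hc X).2 h)
  · exact le_iff_subobjectSupport.2 fun Y hY => ((subobjectSupport_classSubobject hc Y).1 hY).1
  · exact le_iff_subobjectSupport.2 fun Y hY => ((subobjectSupport_classSubobject hc Y).1 hY).2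

end Subterminal

/-! ### Closed classes for the topology of fields -/

theorem RingHom.subsingleton_of_subsingleton {R S : Type*} [CommRing R] [CommRing S]
    (f : R →+* S) [Subsingleton R] : Subsingleton S :=
  subsingleton_of_zero_eq_one (by rw [← map_zero f, ← map_one f, Subsingleton.elim (0 : R) 1])

/-- A property of rings which defines a closed class for the topology of fields. -/
structure IsLocalRingProperty (Q : ∀ (R : Type u) [CommRing R], Prop) : Prop where
  map : ∀ {R S : Type u} [CommRing R] [CommRing S], (R →+* S) → Q R → Q S
  of_subsingleton : ∀ (R : Type u) [CommRing R] [Subsingleton R], Q R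
  prod : ∀ {R S : Type u} [CommRing R] [CommRing S], Q R → Q S → Q (R × S)

/-- The element aa* is an idempotent generating (a), so the two kernels are complementary and R ≅ S
× T. -/
theorem IsLocalRingProperty.of_ker {Q : ∀ (R : Type u) [CommRing R], Prop}
    (hQ : IsLocalRingProperty Q) {R S T : Type u} [CommRing R] [CommRing S] [CommRing T]
    (hR : IsVonNeumannRegular R) (a : R) (f : R →+* S) (g : R →+* T)
    (hf : Function.Surjective f) (hg : Function.Surjective g)
    (hfa : RingHom.ker f = Ideal.span {a})
    (hga : RingHom.ker g = Ideal.span {a * weakInverse a - 1}) (hS : Q S) (hT : Q T) : Q R := by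
  obtain ⟨h1, h2⟩ := hR.weakInverse_spec a
  have hfa' : f a = 0 := (RingHom.mem_ker).1 (hfa ▸ Ideal.mem_span_singleton_self a)
  have hga' : g (a * weakInverse a) = 1 := by
    have : g (a * weakInverse a - 1) = 0 :=
      (RingHom.mem_ker).1 (hga ▸ Ideal.mem_span_singleton_self _)
    rwa [map_sub, map_one, sub_eq_zero] at this
  have hbij : Function.Bijective (f.prod g) := by
    constructor
    · refine (injective_iff_map_eq_zero _).2 fun r hr => ?_
      have hr1 : r ∈ RingHom.ker f := congrArg Prod.fst hr
      have hr2 : r ∈ RingHom.ker g := congrArg Prod.snd hr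
      rw [hfa, Ideal.mem_span_singleton] at hr1
      rw [hga, Ideal.mem_span_singleton] at hr2
      obtain ⟨c, hc⟩ := hr1
      obtain ⟨d, hd⟩ := hr2
      have h3 : a * weakInverse a * r = r := by
        rw [hc]
        linear_combination c * h1
      have h4 : a * weakInverse a * r = 0 := by
        rw [hd]
        linear_combination d * weakInverse a * h1
      rw [← h3, h4]
    · rintro ⟨s, t⟩
      obtain ⟨x, rfl⟩ := hf s
      obtain ⟨y, rfl⟩ := hg t
      -- The idempotent aa* maps to 0 in S and to 1 in T, so this element glues x and y.
      refine ⟨x + a * weakInverse a * (y - x), Prod.ext ?_ ?_⟩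
      · simp [hfa']
      · change g _ = _
        rw [map_add, map_mul, hga']
        simp
  exact hQ.map (RingEquiv.ofBijective _ hbij).symm.toRingHom (hQ.prod hS hT)

/-- The quotient of a finitely presented regular ring by a principal ideal. -/
noncomputable def quotientObj (X : FPRegRing.{u}ᵒᵖ) (b : X.unop.obj) : FPRegRing.{u}ᵒᵖ :=
  Opposite.op ⟨CommRingCat.of (X.unop.obj ⧸ Ideal.span {b}), X.unop.property.quotient_span b⟩

/-- The quotient map to the quotient by a principal ideal, as an arrow. -/
noncomputable def quotientArrow (X : FPRegRing.{u}ᵒᵖ) (b : X.unop.obj) : quotientObj X b ⟶ X :=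
  Quiver.Hom.op (ObjectProperty.homMk (CommRingCat.ofHom (Ideal.Quotient.mk (Ideal.span {b}))))

theorem ringHom_quotientArrow_surjective (X : FPRegRing.{u}ᵒᵖ) (b : X.unop.obj) :
    Function.Surjective (FPRegRing.ringHom (quotientArrow X b)) :=
  Ideal.Quotient.mk_surjective (I := Ideal.span {b})

theorem ker_ringHom_quotientArrow (X : FPRegRing.{u}ᵒᵖ) (b : X.unop.obj) :
    RingHom.ker (FPRegRing.ringHom (quotientArrow X b)) = Ideal.span {b} :=
  Ideal.mk_ker (I := Ideal.span {b})

theorem exists_comp_quotientArrow {X Y : FPRegRing.{u}ᵒᵖ} (f : Y ⟶ X) (b : X.unop.obj) :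
    ∃ g : quotientObj Y (FPRegRing.ringHom f b) ⟶ quotientObj X b,
      g ≫ quotientArrow X b = quotientArrow Y (FPRegRing.ringHom f b) ≫ f := by
  have h : Ideal.span {b} ≤
      (Ideal.span {FPRegRing.ringHom f b}).comap (FPRegRing.ringHom f) := by
    rw [Ideal.span_singleton_le_iff_mem]
    exact Ideal.mem_span_singleton_self (FPRegRing.ringHom f b)
  exact ⟨Quiver.Hom.op (ObjectProperty.homMk (CommRingCat.ofHom
    (Ideal.quotientMap (Ideal.span {FPRegRing.ringHom f b}) (FPRegRing.ringHom f) h))), rfl⟩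

theorem IsLocalRingProperty.isClosedClass {Q : ∀ (R : Type u) [CommRing R], Prop}
    (hQ : IsLocalRingProperty Q) :
    IsClosedClass fieldTopology.{u} fun X => Q X.unop.obj := by
  have hom {X Y : FPRegRing.{u}ᵒᵖ} (f : Y ⟶ X) : Q X.unop.obj → Q Y.unop.obj :=
    hQ.map (FPRegRing.ringHom f)
  refine ⟨hom, fun {X} S hS h => ?_⟩
  -- By minimality of the field topology only the generating covers matter, but the sheaf condition
  -- must be checked on all their pullbacks. The pullback along f of the cover for a contains the
  -- two quotient maps for f(a).
  have hle : fieldTopology.{u} ≤ Sheaf.finestTopologySingle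
      (classPresheaf.{u} (fun X : FPRegRing.{u}ᵒᵖ => Q X.unop.obj) hom) := by
    refine sInf_le ⟨fun X hX Y f => ?_, fun X a Y f => ?_⟩
    · refine classPresheaf_isSheafFor fun _ => ?_
      have : Subsingleton Y.unop.obj := (FPRegRing.ringHom f).subsingleton_of_subsingleton
      exact hQ.of_subsingleton _
    · refine classPresheaf_isSheafFor fun hcov => ?_
      have hreg := X.unop.property.1
      have key (b : X.unop.obj) (hb : fieldPresieve X a (quotientArrow X b)) :
          Q (quotientObj Y (FPRegRing.ringHom f b)).unop.obj := by
        obtain ⟨g, hg⟩ := exists_comp_quotientArrow f b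
        exact hcov (quotientArrow Y (FPRegRing.ringHom f b)) ⟨_, g, _, hb, hg⟩
      refine hQ.of_ker Y.unop.property.1 (FPRegRing.ringHom f a)
        (FPRegRing.ringHom (quotientArrow Y _)) (FPRegRing.ringHom (quotientArrow Y _))
        (ringHom_quotientArrow_surjective Y _) (ringHom_quotientArrow_surjective Y _)
        (ker_ringHom_quotientArrow Y _) ?_
        (key a ⟨ringHom_quotientArrow_surjective X _, .inl (ker_ringHom_quotientArrow X _)⟩)
        (key (a * weakInverse a - 1)
          ⟨ringHom_quotientArrow_surjective X _, .inr (ker_ringHom_quotientArrow X _)⟩)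
      rw [ker_ringHom_quotientArrow, map_sub, map_mul, map_one, hreg.map_weakInverse]
  have := hle X hS X (𝟙 X)
  rw [Sieve.pullback_id] at this
  exact of_classPresheaf_isSheafFor (P := fun X : FPRegRing.{u}ᵒᵖ => Q X.unop.obj) this h

/-- The subobject of the terminal sheaf given by a property of rings. -/
noncomputable def IsLocalRingProperty.subobject {Q : ∀ (R : Type u) [CommRing R], Prop}
    (hQ : IsLocalRingProperty Q) : Subobject (trueSheaf.{u} fieldTopology.{u}) :=
  classSubobject hQ.isClosedClass

theorem IsLocalRingProperty.support_subobject {Q : ∀ (R : Type u) [CommRing R], Prop}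
    (hQ : IsLocalRingProperty Q) (X : FPRegRing.{u}ᵒᵖ) :
    subobjectSupport hQ.subobject X ↔ Q X.unop.obj :=
  subobjectSupport_classSubobject hQ.isClosedClass X

/-! ### Ring properties attached to sets of primes -/

/-- Some product of primes in `S` vanishes in `R`. -/
def HasTorsionIn (S : Set ℕ) (R : Type u) [CommRing R] : Prop :=
  ∃ n : ℕ, n ≠ 0 ∧ (∀ p, p.Prime → p ∣ n → p ∈ S) ∧ (n : R) = 0

/-- All elements of `S` are invertible in `R`. -/
def AreUnitsIn (S : Set ℕ) (R : Type u) [CommRing R] : Prop :=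
  ∀ p ∈ S, IsUnit (p : R)

/-- An idempotent separates `S` from `T`: the elements of `S` are invertible on its zero locus
and those of `T` are invertible on the complement. -/
def HasSeparatingIdempotent (S T : Set ℕ) (R : Type u) [CommRing R] : Prop :=
  ∃ e : R, e * e = e ∧ (∀ p ∈ S, IsCoprime (p : R) e) ∧ ∀ p ∈ T, IsCoprime (p : R) (1 - e)

theorem isLocalRingProperty_subsingleton :
    IsLocalRingProperty.{u} fun R _ => Subsingleton R where
  map f _ := f.subsingleton_of_subsingleton
  of_subsingleton _ _ h := h
  prod _ _ := inferInstance

/-- Stability under products is why a product of primes is allowed to vanish, not just a single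
prime: the witnesses n and m of the factors combine to nm. The empty product takes care of the zero
ring. -/
theorem isLocalRingProperty_hasTorsionIn (S : Set ℕ) :
    IsLocalRingProperty.{u} fun R _ => HasTorsionIn S R where
  map := fun f ⟨n, hn, hS, h⟩ => ⟨n, hn, hS, by rw [← map_natCast f, h, map_zero]⟩
  of_subsingleton _ _ _ := ⟨1, one_ne_zero, fun p hp h => (hp.one_lt.ne' (Nat.dvd_one.1 h)).elim,
    Subsingleton.elim _ _⟩
  prod := fun ⟨n, hn, hS, h⟩ ⟨m, hm, hS', h'⟩ => ⟨n * m, mul_ne_zero hn hm,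
    fun p hp hd => (hp.dvd_mul.1 hd).elim (hS p hp) (hS' p hp),
    Prod.ext (by simp [h]) (by simp [h'])⟩

theorem isLocalRingProperty_areUnitsIn (S : Set ℕ) :
    IsLocalRingProperty.{u} fun R _ => AreUnitsIn S R where
  map f h p hp := map_natCast f p ▸ (h p hp).map f
  of_subsingleton _ _ _ _ _ := isUnit_of_subsingleton _
  prod h h' p hp := Prod.isUnit_iff.2 ⟨h p hp, h' p hp⟩

theorem IsCoprime.prodMk {R S : Type*} [CommRing R] [CommRing S] {a b : R × S}
    (h : IsCoprime a.1 b.1) (h' : IsCoprime a.2 b.2) : IsCoprime a b := by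
  obtain ⟨u, v, h⟩ := h
  obtain ⟨u', v', h'⟩ := h'
  exact ⟨(u, u'), (v, v'), Prod.ext h h'⟩

theorem isLocalRingProperty_hasSeparatingIdempotent (S T : Set ℕ) :
    IsLocalRingProperty.{u} fun R _ => HasSeparatingIdempotent S T R where
  map := fun f ⟨e, he, hS, hT⟩ => ⟨f e, by rw [← map_mul, he],
    fun p hp => by simpa using (hS p hp).map f, fun p hp => by simpa using (hT p hp).map f⟩
  of_subsingleton _ _ _ := ⟨0, Subsingleton.elim _ _,
    fun p _ => ⟨0, 0, Subsingleton.elim _ _⟩, fun p _ => ⟨0, 0, Subsingleton.elim _ _⟩⟩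
  prod := fun ⟨e, he, hS, hT⟩ ⟨e', he', hS', hT'⟩ => ⟨(e, e'), Prod.ext he he',
    fun p hp => .prodMk (hS p hp) (hS' p hp), fun p hp => .prodMk (hT p hp) (hT' p hp)⟩

theorem HasTorsionIn.subsingleton_of_areUnitsIn {S : Set ℕ} {R : Type u} [CommRing R]
    (h : HasTorsionIn S R) (h' : AreUnitsIn S R) : Subsingleton R := by
  obtain ⟨n, hn, hS, h0⟩ := h
  have hu (m : ℕ) (hm : m ≠ 0) (hS : ∀ p, p.Prime → p ∣ m → p ∈ S) : IsUnit (m : R) := by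
    induction m using Nat.recOnMul with
    | zero => exact (hm rfl).elim
    | one => simp
    | prime p hp => exact h' p (hS p hp dvd_rfl)
    | mul a b ha hb =>
      rw [Nat.cast_mul]
      exact (ha (left_ne_zero_of_mul hm) fun p hp hd => hS p hp (hd.mul_right b)).mul
        (hb (right_ne_zero_of_mul hm) fun p hp hd => hS p hp (hd.mul_left a))
  have := hu n hn hS
  rw [h0, isUnit_zero_iff] at this
  exact subsingleton_of_zero_eq_one this

theorem HasTorsionIn.subsingleton_of_disjoint {S T : Set ℕ} (hST : Disjoint S T) {R : Type u}
    [CommRing R] (h : HasTorsionIn S R) (h' : HasTorsionIn T R) : Subsingleton R := by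
  obtain ⟨n, hn, hS, h0⟩ := h
  obtain ⟨m, hm, hT, h0'⟩ := h'
  have hc : Nat.Coprime n m := Nat.coprime_of_dvd fun p hp hd hd1 =>
    Set.disjoint_left.1 hST (hS p hp hd) (hT p hp hd1)
  obtain ⟨a, b, h⟩ := hc.cast (R := R)
  rw [h0, h0'] at h
  exact subsingleton_of_zero_eq_one (by simpa using h)

/-- An integer is zero if it is divisible by the elements of an infinite set that do not divide a
fixed nonzero integer. -/
theorem Int.eq_zero_of_infinite_dvd {S : Set ℕ} (hS : S.Infinite) {a : ℤ} {N : ℤ}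
    (hN : N ≠ 0) (h : ∀ p ∈ S, ¬ (p : ℤ) ∣ N → (p : ℤ) ∣ a) : a = 0 := by
  by_contra ha
  have hNa : (N * a).natAbs ≠ 0 := Int.natAbs_ne_zero.2 (mul_ne_zero hN ha)
  -- Whether or not p divides N, it divides Na, which is too small in absolute value unless it is
  -- zero.
  obtain ⟨p, hpS, hlt⟩ := hS.exists_gt (N * a).natAbs
  have hd : (p : ℤ) ∣ N * a := by
    by_cases hd : (p : ℤ) ∣ N
    · exact hd.mul_right a
    · exact (h p hpS hd).mul_left N
  exact absurd (Nat.le_of_dvd (Nat.pos_of_ne_zero hNa) (Int.natCast_dvd.1 hd)) hlt.not_ge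

theorem not_hasSeparatingIdempotent_closedTermRing {S T : Set ℕ} (hS : S.Infinite)
    (hT : T.Infinite) (hSp : ∀ p ∈ S, p.Prime) (hTp : ∀ p ∈ T, p.Prime) :
    ¬ HasSeparatingIdempotent S T (ULift.{u} ClosedTermRing.{u}) := by
  rintro ⟨⟨e⟩, he, heS, heT⟩
  obtain ⟨t, rfl⟩ := ClosedTermRing.mk_surjective e
  obtain ⟨N, a, hN, hNa⟩ := t.exists_mul_eval_eq_intCast
  have key (p : ℕ) (hp : p.Prime) (hpN : ¬ (p : ℤ) ∣ N) :
      ∃ φ : ULift.{u} ClosedTermRing.{u} →+* ZMod p,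
        (N : ZMod p) * φ ⟨ClosedTermRing.mk t⟩ = a := by
    have : Fact p.Prime := ⟨hp⟩
    let : Field (ULift.{u} (ZMod p)) := ULift.field
    let ψ := ClosedTermRing.lift (ULift.{u} (ZMod p)) (.of_field _)
    refine ⟨(ULift.ringEquiv.toRingHom.comp ψ).comp ULift.ringEquiv.toRingHom, ?_⟩
    have h0 : (N : ULift.{u} (ZMod p)) ≠ 0 := fun h =>
      hpN ((ZMod.intCast_zmod_eq_zero_iff_dvd N p).1 (congrArg ULift.down h))
    exact congrArg ULift.down (hNa _ h0)
  have one_of_S : a - N = 0 := by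
    refine Int.eq_zero_of_infinite_dvd hS hN fun p hp hpN => ?_
    have : Fact p.Prime := ⟨hSp p hp⟩
    obtain ⟨φ, hφ⟩ := key p (hSp p hp) hpN
    have hc := (heS p hp).map φ
    rw [map_natCast, ZMod.natCast_self, isCoprime_zero_left] at hc
    -- As p = 0 in 𝔽_p, coprimality makes the image of e a unit, and an idempotent unit is 1.
    have h1 : φ ⟨ClosedTermRing.mk t⟩ = 1 := hc.mul_left_cancel (by rw [← map_mul, he, mul_one])
    rw [← ZMod.intCast_zmod_eq_zero_iff_dvd, Int.cast_sub, ← hφ, h1, mul_one, sub_self]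
  have zero_of_T : a = 0 := by
    refine Int.eq_zero_of_infinite_dvd hT hN fun p hp hpN => ?_
    have : Fact p.Prime := ⟨hTp p hp⟩
    obtain ⟨φ, hφ⟩ := key p (hTp p hp) hpN
    have hc := (heT p hp).map φ
    rw [map_natCast, ZMod.natCast_self, isCoprime_zero_left] at hc
    have h0 : φ ⟨ClosedTermRing.mk t⟩ = 0 := by
      refine hc.mul_left_cancel ?_
      rw [← map_mul, sub_mul, he, one_mul, sub_self, map_zero, mul_zero]
    rw [← ZMod.intCast_zmod_eq_zero_iff_dvd, ← hφ, h0, mul_zero]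
  omega

/-! ### Failure of De Morgan's law -/

theorem isBot_of_subobjectSupport {x : Subobject (trueSheaf.{u} fieldTopology.{u})}
    (h : ∀ X, subobjectSupport x X → Subsingleton X.unop.obj) : IsBot x := by
  intro y
  refine le_iff_subobjectSupport.2 fun X hX => ?_
  have := h X hX
  -- The zero ring is covered by the empty sieve, so every subobject has a section over it.
  refine (isClosedClass_subobjectSupport y).of_cover ⊥ ?_ fun _ _ hf => hf.elim
  exact GrothendieckTopology.mem_sInf _ _ |>.2 fun J hJ => hJ.1 X this

theorem subsingleton_of_isBot {x : Subobject (trueSheaf.{u} fieldTopology.{u})} (hx : IsBot x)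
    {X : FPRegRing.{u}ᵒᵖ} (hX : subobjectSupport x X) : Subsingleton X.unop.obj :=
  (isLocalRingProperty_subsingleton.support_subobject X).1 (subobjectSupport_mono (hx _) hX)

theorem isBot_inf_iff (x y : Subobject (trueSheaf.{u} fieldTopology.{u})) :
    IsBot (x ⊓ y) ↔ ∀ X : FPRegRing.{u}ᵒᵖ, subobjectSupport x X → subobjectSupport y X →
      Subsingleton X.unop.obj :=
  ⟨fun h X hx hy => subsingleton_of_isBot h ((subobjectSupport_inf x y X).2 ⟨hx, hy⟩),
    fun h => isBot_of_subobjectSupport fun X hX =>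
      let h' := (subobjectSupport_inf x y X).1 hX
      h X h'.1 h'.2⟩

theorem hasTorsionIn_quotientObj {S : Set ℕ} {p : ℕ} (hpS : p ∈ S) (hp : p.Prime)
    (X : FPRegRing.{u}ᵒᵖ) : HasTorsionIn S (quotientObj X (p : X.unop.obj)).unop.obj := by
  refine ⟨p, hp.ne_zero, fun q hq hd => ((Nat.prime_dvd_prime_iff_eq hq hp).1 hd) ▸ hpS, ?_⟩
  have h : FPRegRing.ringHom (quotientArrow X (p : X.unop.obj)) p = 0 := by
    rw [← RingHom.mem_ker, ker_ringHom_quotientArrow]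
    exact Ideal.mem_span_singleton_self _
  rw [← h, map_natCast]

/-- The negation of the subobject defined by `HasTorsionIn S` is defined by `AreUnitsIn S`. -/
theorem isNegation_hasTorsionIn {S : Set ℕ} (hS : ∀ p ∈ S, p.Prime) :
    IsNegation (isLocalRingProperty_hasTorsionIn.{u} S).subobject
      (isLocalRingProperty_areUnitsIn.{u} S).subobject := by
  have hA := (isLocalRingProperty_hasTorsionIn.{u} S).support_subobject
  have hA' := (isLocalRingProperty_areUnitsIn.{u} S).support_subobject
  refine ⟨(isBot_inf_iff _ _).2 fun X h h' => ?_, fun x hx => ?_⟩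
  · exact ((hA X).1 h).subsingleton_of_areUnitsIn ((hA' X).1 h')
  · refine le_iff_subobjectSupport.2 fun X hX => (hA' X).2 fun p hp => ?_
    -- A section over R restricts to R/(p), where p is torsion. Disjointness then gives R/(p) = 0,
    -- so p is invertible in R.
    have hq : subobjectSupport x (quotientObj X (p : X.unop.obj)) :=
      (isClosedClass_subobjectSupport x).of_hom (quotientArrow X _) hX
    have hs := (isBot_inf_iff _ _).1 hx _
      ((hA _).2 (hasTorsionIn_quotientObj hp (hS p hp) X)) hq
    exact Ideal.span_singleton_eq_top.1 (Ideal.Quotient.subsingleton_iff.1 hs)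

/-- This is Dirichlet's theorem; the main argument only needs two disjoint infinite sets of primes.
-/
theorem infinite_primes_eq_mod_four {a : ℕ} (ha : Nat.Coprime a 4) :
    {p : ℕ | p.Prime ∧ (p : ZMod 4) = a}.Infinite :=
  Nat.infinite_setOfPred_prime_and_eq_mod ((ZMod.isUnit_iff_coprime a 4).2 ha)

theorem proposition1p4 :
    ¬ SatisfiesDeMorgan (Sheaf fieldTopology.{u} (Type u)) := by
  intro hDM
  let S : Set ℕ := {p : ℕ | p.Prime ∧ (p : ZMod 4) = (1 : ℕ)}
  let T : Set ℕ := {p : ℕ | p.Prime ∧ (p : ZMod 4) = (3 : ℕ)}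
  have hS : ∀ p ∈ S, p.Prime := fun p hp => hp.1
  have hT : ∀ p ∈ T, p.Prime := fun p hp => hp.1
  have hST : Disjoint S T := Set.disjoint_left.2 fun p hp hq =>
    absurd (hp.2.symm.trans hq.2) (by decide)
  have hA := (isLocalRingProperty_hasTorsionIn.{u} S).support_subobject
  have hB := (isLocalRingProperty_hasTorsionIn.{u} T).support_subobject
  have hA' := (isLocalRingProperty_areUnitsIn.{u} S).support_subobject
  have hB' := (isLocalRingProperty_areUnitsIn.{u} T).support_subobject
  have hU := (isLocalRingProperty_hasSeparatingIdempotent.{u} S T).support_subobject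
  have htop : IsNegation ((isLocalRingProperty_hasTorsionIn.{u} S).subobject ⊓
      (isLocalRingProperty_hasTorsionIn.{u} T).subobject) ⊤ := by
    refine ⟨(isBot_inf_iff _ _).2 fun X h _ => ?_, fun _ _ => le_top⟩
    exact ((hA X).1 (subobjectSupport_mono inf_le_left h)).subsingleton_of_disjoint hST
      ((hB X).1 (subobjectSupport_mono inf_le_right h))
  have hlub := hDM _ _ _ _ _ ⊤ (isNegation_hasTorsionIn hS) (isNegation_hasTorsionIn hT) htop
  have hleA : (isLocalRingProperty_areUnitsIn.{u} S).subobject ≤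
      (isLocalRingProperty_hasSeparatingIdempotent.{u} S T).subobject :=
    le_iff_subobjectSupport.2 fun X hX => (hU X).2
      ⟨0, mul_zero 0, fun p hp => isCoprime_zero_right.2 ((hA' X).1 hX p hp),
        fun p _ => by simpa using isCoprime_one_right⟩
  have hleB : (isLocalRingProperty_areUnitsIn.{u} T).subobject ≤
      (isLocalRingProperty_hasSeparatingIdempotent.{u} S T).subobject :=
    le_iff_subobjectSupport.2 fun X hX => (hU X).2
      ⟨1, mul_one 1, fun p _ => isCoprime_one_right, fun p hp => by
        rw [sub_self]
        exact isCoprime_zero_right.2 ((hB' X).1 hX p hp)⟩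
  -- The join need not be computed: U is an upper bound of ¬A (with e = 0) and of ¬B (with e = 1),
  -- so it would have to be everything.
  have hle : ⊤ ≤ (isLocalRingProperty_hasSeparatingIdempotent.{u} S T).subobject :=
    hlub.2 (by rintro _ (rfl | rfl) <;> assumption)
  let I : FPRegRing.{u}ᵒᵖ :=
    Opposite.op ⟨CommRingCat.of (ULift.{u} ClosedTermRing.{u}), ClosedTermRing.isFPRegularRing⟩
  have hI : subobjectSupport (⊤ : Subobject (trueSheaf.{u} fieldTopology.{u})) I :=
    subobjectSupport_mono le_top
      ((subobjectSupport_classSubobject.{u} IsClosedClass.true I).2 trivial)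
  exact not_hasSeparatingIdempotent_closedTermRing
    (infinite_primes_eq_mod_four (by decide)) (infinite_primes_eq_mod_four (by decide))
    hS hT ((hU I).1 (subobjectSupport_mono hle hI))
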